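/- A multigraph on $[n]=\{1,\dots,n\}$ is a function $w:\binom{[n]}{2}\to\{0,1,2,\dots\}$. For integers $s\ge 2$, $q\ge 0$ let $F(n,s,q)$ be the set of multigraphs $G=([n],w)$ such that $\sum_{xy\in\binom X2}w(xy)\le q$ for every $X\subseteq[n]$ with $|X|=s$. Put $P(G)=\prod_{xy\in\binom{[n]}2}w(xy)$, and for $n\ge s$ let $\mathrm{ex}_\Pi(n,s,q)=\max\{P(G):G\in F(n,s,q)\}$ and $\mathcal P(n,s,q)=\{G\in F(n,s,q):P(G)=\mathrm{ex}_\Pi(n,s,q)\}$. Let $\mathrm{ex}_\Pi(s,q)=\lim_{n\to\infty}\mathrm{ex}_\Pi(n,s,q)^{1/\binom n2}$. Let $\mathbb U_a(n)$ be the multigraph on $[n]$ with all multiplicities equal to $a$. For $k\ge1$ let $\mathbb U_{k,a}(n)$ be the set of multigraphs $([n],w)$ for which there is a partition $[n]=A_0\cup A_1\cup\dots\cup A_{\lfloor n/k\rfloor}$ with $|A_i|=k$ for $i\ge1$ and $|A_0|=n-k\lfloor n/k\rfloor$ (possibly $A_0=\emptyset$) such that, inside each nonempty $A_i$, the pairs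 of multiplicity $a+1$ are the $|A_i|-1$ edges of a spanning star of $A_i$, and all other pairs of vertices of $[n]$ have multiplicity $a$. Two multigraphs on $[n]$ are $\delta$-close if their multiplicities differ on at most $\delta n^2$ pairs. **Theorem.** Let $s,q,a,b$ be integers with $s\ge2$, $a\ge1$, $0\le b\le s-2$ and $q=a\binom s2+b$. * (Extremal) For all $n\ge s$, $$a^{\binom n2}\le \mathrm{ex}_\Pi(n,s,q)\le a^{\binom n2}\Big(\frac{a+1}a\Big)^{\lfloor \frac{b}{b+1}n\rfloor},$$ and the limit $\mathrm{ex}_\Pi(s,q)$ exists and equals $a$. Further, for all $n\ge s$: (a) if $b=0$, then $\mathcal P(n,s,q)=\{\mathbb U_a(n)\}$ and $\mathrm{ex}_\Pi(n,s,q)=a^{\binom n2}$; (b) if $b=s-2$, then $\mathbb U_{s-1,a}(n)\subseteq\mathcal P(n,s,q)$ and $\mathrm{ex}_\Pi(n,s,q)=a^{\binom n2}\big(\frac{a+1}a\big)^{\lfloor (s-2)n/(s-1)\rfloor}$; if moreover $s=3$, then $\mathcal P(n,3,q)=\mathbb U_{2,a}(n)$. * (Stability) For all $\delta>0$ there are $\epsilon>0$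 and $M$ such that for all $n>M$ and all $G\in F(n,s,q)$, if $P(G)>\mathrm{ex}_\Pi(n,s,q)^{1-\epsilon}$, then $G$ is $\delta$-close to $\mathbb U_a(n)$. -/

import Mathlib

namespace WeightedPairs

/-- `Pair V` is the set of unordered pairs of distinct elements of `V`. -/
abbrev Pair (V : Type) : Type := {e : Sym2 V // ¬ e.IsDiag}

/-- A multigraph with vertex set `V`: every unordered pair of distinct vertices gets a
multiplicity in `ℕ = {0, 1, 2, …}`. -/
abbrev Multigraph (V : Type) : Type := Pair V → ℕ

section finite

variable {V : Type} [Fintype V] [DecidableEq V]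

/-- The pairs of distinct vertices that lie inside `X`. -/
def pairsIn (X : Finset V) : Finset (Pair V) :=
  Finset.univ.filter (fun e => e.1 ∈ X.sym2)

/-- Every set of `s` vertices spans at most `q` edges, counted with multiplicity. -/
def IsSQGraph (s q : ℕ) (G : Multigraph V) : Prop :=
  ∀ X : Finset V, X.card = s → ∑ e ∈ pairsIn X, G e ≤ q

/-- The product `P(G)` of all the multiplicities. -/
def edgeProd (G : Multigraph V) : ℕ := ∏ e, G e

/-- The set `Δ(G, G')` of the pairs on which two multigraphs differ. -/
def diffPairs (G G' : Multigraph V) : Finset (Pair V) :=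
  Finset.univ.filter (fun e => G e ≠ G' e)

/-- `G` and `G'` are `δ`-close: they differ on at most `δ |V|²` pairs. -/
def IsClose (δ : ℝ) (G G' : Multigraph V) : Prop :=
  ((diffPairs G G').card : ℝ) ≤ δ * (Fintype.card V : ℝ) ^ 2

/-- Inside `A`, the pairs of multiplicity `a + 1` are the `|A| - 1` edges of a spanning star of `A`
(with centre `c`), and all other pairs have multiplicity `a`.  No condition if `A` is empty. -/
def IsStarOn (a : ℕ) (G : Multigraph V) (A : Finset V) : Prop :=
  A.Nonempty → ∃ c ∈ A, ∀ e ∈ pairsIn A, G e = if c ∈ e.1 then a + 1 else a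

end finite

/-- `F(n, s, q)`: the `(s, q)`-graphs with vertex set `[n]`. -/
def graphsF (n s q : ℕ) : Set (Multigraph (Fin n)) := {G | IsSQGraph s q G}

/-- `ex_Π(n, s, q)`, the largest value of `P(G)` over `F(n, s, q)`
(for `n ≥ s ≥ 2` it is attained: see `isGreatest_exProd`). -/
noncomputable def exProd (n s q : ℕ) : ℕ := sSup (edgeProd '' graphsF n s q)

/-- The set of the product-extremal `(s, q)`-graphs with vertex set `[n]`. -/
def prodExtremal (n s q : ℕ) : Set (Multigraph (Fin n)) :=
  {G | G ∈ graphsF n s q ∧ edgeProd G = exProd n s q}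

/-- The asymptotic product density `lim_{n → ∞} ex_Π(n, s, q) ^ (1 / (n choose 2))` exists and
equals `L`. -/
def HasProdDensity (s q : ℕ) (L : ℝ) : Prop :=
  Filter.Tendsto (fun n : ℕ => (exProd n s q : ℝ) ^ (1 / (n.choose 2 : ℝ)))
    Filter.atTop (nhds L)

/-- The constant multigraph `𝕌_a(n)`. -/
def constGraph (n a : ℕ) : Multigraph (Fin n) := fun _ => a

/-- `𝕌_{k,a}(n)`: the vertex set is partitioned into `⌊n/k⌋` parts of size `k` and one
(possibly empty) remainder part `A 0`; each part carries a spanning star of multiplicity `a + 1`,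
and all pairs that are not in one of these stars have multiplicity `a`. -/
def starBlocks (n k a : ℕ) : Set (Multigraph (Fin n)) :=
  {G | ∃ A : Fin (n / k + 1) → Finset (Fin n),
      (∀ i j, i ≠ j → Disjoint (A i) (A j)) ∧
      (∀ v, ∃ i, v ∈ A i) ∧
      (∀ i, i ≠ 0 → (A i).card = k) ∧
      (A 0).card = n - k * (n / k) ∧
      (∀ i, IsStarOn a G (A i)) ∧
      (∀ e, (∀ i, e ∉ pairsIn (A i)) → G e = a)}

theorem isGreatest_exProd {n s q : ℕ} (hs : 2 ≤ s) (hn : s ≤ n) :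
    IsGreatest (edgeProd '' graphsF n s q) (exProd n s q) := by
  have hb : BddAbove (edgeProd '' graphsF n s q) := by
    refine ⟨q ^ Fintype.card (Pair (Fin n)), ?_⟩
    rintro _ ⟨G, hG, rfl⟩
    refine Finset.prod_le_pow_card _ _ _ fun e _ => ?_
    obtain ⟨X, hX, hXs⟩ := Finset.exists_superset_card_eq (s := e.1.toFinset) (n := s)
      (by rw [Sym2.card_toFinset_of_not_isDiag _ e.2]; exact hs) (by simpa using hn)
    refine le_trans ?_ (hG X hXs)
    refine Finset.single_le_sum (f := G) (fun _ _ => Nat.zero_le _) ?_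
    simp only [pairsIn, Finset.mem_filter, Finset.mem_univ, true_and, Finset.mem_sym2_iff]
    exact fun v hv => hX (Sym2.mem_toFinset.2 hv)
  have hne : (edgeProd '' graphsF n s q).Nonempty :=
    ⟨_, (fun _ => 0 : Multigraph (Fin n)), fun X _ => by simp, rfl⟩
  exact ⟨Nat.sSup_mem hne hb, fun _ h => le_csSup hb h⟩

end WeightedPairs

/-! Let d = w − a be the excess of a pair and r = (a+1)/a. Bernoulli's inequality gives w ≤
a·r^(w−a) for every natural number w, with equality only for w = a and w = a+1. Multiplying over all
N = C(n,2) pairs, P(G) ≤ a^N · r^D with D the total excess, so the product problem becomes an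
additive one: integer pair weights, possibly negative, whose sum on each s-set is at most b.

The core is `weight_bound`: such weights have total D ≤ bn/(b+1). Small vertex sets are settled by
averaging over vertex deletions. In a large set one cuts off a heavy subset Y to which every outside
vertex sends little weight, and bounds the rest by induction or by averaging.

For s = b+2 the bound is attained by forests of stars on b+1 vertices; for s = 3 the equality case
forces a maximum matching. Since D ≤ n, the factor r^D vanishes in the N-th root, which gives the
density. Stability uses a fixed factor below 1 gained in the pointwise inequality at each pair with
w < a, so there are few such pairs; D ≤ n then limits the pairs with w > a. -/

namespace WeightedPairs

/-! ### Additive problem: integer pair weights bounded on s-sets. -/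

section weight

variable {V : Type} [DecidableEq V]

/-- The weight of the pair `xy`, extended by `0` to `x = y`. -/
def pairWeight (d : Pair V → ℤ) (x y : V) : ℤ :=
  if h : x = y then 0 else d ⟨s(x, y), by simpa using h⟩

theorem pairWeight_self (d : Pair V → ℤ) (x : V) : pairWeight d x x = 0 := by
  simp [pairWeight]

theorem pairWeight_comm (d : Pair V → ℤ) (x y : V) : pairWeight d x y = pairWeight d y x := by
  unfold pairWeight
  by_cases h : x = y
  · simp [h]
  · have h' : ¬ y = x := fun h' => h h'.symm
    simp only [h, h', dite_false]
    congr 2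
    exact Sym2.eq_swap

variable [Fintype V]

/-- The total weight of the pairs inside `X`. -/
def weight (d : Pair V → ℤ) (X : Finset V) : ℤ := ∑ e ∈ pairsIn X, d e

theorem mem_pairsIn {X : Finset V} {e : Pair V} : e ∈ pairsIn X ↔ ∀ v ∈ e.1, v ∈ X := by
  simp [pairsIn, Finset.mem_sym2_iff]

theorem pairsIn_univ : pairsIn (Finset.univ : Finset V) = Finset.univ := by
  ext e
  simp [mem_pairsIn]

theorem weight_univ (d : Pair V → ℤ) : weight d Finset.univ = ∑ e, d e := by
  rw [weight, pairsIn_univ]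

theorem weight_empty (d : Pair V → ℤ) : weight d ∅ = 0 := by
  simp [weight, pairsIn]

theorem weight_insert (d : Pair V → ℤ) {v : V} {X : Finset V} (hv : v ∉ X) :
    weight d (insert v X) = weight d X + ∑ y ∈ X, pairWeight d v y := by
  have hsplit : pairsIn (insert v X) =
      pairsIn X ∪ (pairsIn (insert v X)).filter (fun e => v ∈ e.1) := by
    ext e
    simp only [Finset.mem_union, Finset.mem_filter, mem_pairsIn, Finset.mem_insert]
    constructor
    · intro h
      by_cases hve : v ∈ e.1
      · exact Or.inr ⟨h, hve⟩
      · refine Or.inl fun w hw => ?_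
        rcases h w hw with rfl | h
        · exact absurd hw hve
        · exact h
    · rintro (h | h)
      · exact fun w hw => Or.inr (h w hw)
      · exact h.1
  have hdisj : Disjoint (pairsIn X) ((pairsIn (insert v X)).filter (fun e => v ∈ e.1)) := by
    rw [Finset.disjoint_left]
    intro e he he'
    exact hv (mem_pairsIn.1 he v (Finset.mem_filter.1 he').2)
  unfold weight
  rw [hsplit, Finset.sum_union hdisj, add_right_inj]
  symm
  have hne : ∀ y ∈ X, v ≠ y := fun y hy h => hv (h ▸ hy)
  refine Finset.sum_bij (fun y hy => (⟨s(v, y), by simpa using hne y hy⟩ : Pair V)) ?_ ?_ ?_ ?_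
  · intro y hy
    simp [mem_pairsIn, hy]
  · intro y hy z hz h
    exact Sym2.congr_right.1 (congrArg Subtype.val h)
  · rintro ⟨e, he⟩ h
    simp only [Finset.mem_filter, mem_pairsIn] at h
    obtain ⟨y, rfl⟩ := Sym2.mem_iff_exists.1 h.2
    have hvy : v ≠ y := by simpa using he
    refine ⟨y, ?_, rfl⟩
    have := h.1 y (by simp)
    simpa [hvy.symm] using this
  · intro y hy
    simp [pairWeight, hne y hy]

theorem weight_singleton (d : Pair V → ℤ) (v : V) : weight d {v} = 0 := by
  have := weight_insert d (Finset.notMem_empty v)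
  simpa [weight_empty] using this

theorem two_mul_weight (d : Pair V → ℤ) (X : Finset V) :
    2 * weight d X = ∑ x ∈ X, ∑ y ∈ X, pairWeight d x y := by
  induction X using Finset.induction_on with
  | empty => simp [weight_empty]
  | insert v X hv ih =>
    rw [weight_insert d hv, Finset.sum_insert hv, Finset.sum_insert hv, pairWeight_self]
    have : ∀ x ∈ X, ∑ y ∈ insert v X, pairWeight d x y =
        pairWeight d v x + ∑ y ∈ X, pairWeight d x y := fun x _ => by
      rw [Finset.sum_insert hv, pairWeight_comm]
    rw [Finset.sum_congr rfl this, Finset.sum_add_distrib, ← ih]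
    ring

theorem weight_union (d : Pair V → ℤ) {Y Z : Finset V} (h : Disjoint Y Z) :
    weight d (Y ∪ Z) =
      weight d Y + weight d Z + ∑ z ∈ Z, (weight d (insert z Y) - weight d Y) := by
  induction Z using Finset.induction_on with
  | empty => simp [weight_empty]
  | insert z Z hz ih =>
    rw [Finset.disjoint_insert_right] at h
    have hzu : z ∉ Y ∪ Z := by simp [h.1, hz]
    rw [Finset.union_insert, weight_insert d hzu, ih h.2, weight_insert d hz,
      Finset.sum_insert hz, weight_insert d h.1, Finset.sum_union h.2]
    ring

/-- Double counting: a pair inside X survives every deletion except those of its two endpoints. -/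
theorem sum_weight_erase (d : Pair V → ℤ) (X : Finset V) :
    ∑ v ∈ X, weight d (X.erase v) = ((X.card : ℤ) - 2) * weight d X := by
  have h : ∀ v ∈ X, weight d (X.erase v) = weight d X - ∑ y ∈ X, pairWeight d v y := by
    intro v hv
    have h1 := weight_insert d (Finset.notMem_erase v X)
    rw [Finset.insert_erase hv] at h1
    have h2 := Finset.add_sum_erase X (pairWeight d v) hv
    rw [pairWeight_self] at h2
    linarith
  rw [Finset.sum_congr rfl h, Finset.sum_sub_distrib, ← two_mul_weight]
  simp
  ring

theorem exists_weight_erase_ge (d : Pair V → ℤ) {X : Finset V} (hX : X.Nonempty) :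
    ∃ v ∈ X, ((X.card : ℤ) - 2) * weight d X ≤ X.card * weight d (X.erase v) := by
  have h : ∑ v ∈ X, ((X.card : ℤ) - 2) * weight d X ≤
      ∑ v ∈ X, (X.card : ℤ) * weight d (X.erase v) := by
    rw [Finset.sum_const, nsmul_eq_mul, ← Finset.mul_sum, sum_weight_erase]
  exact Finset.exists_le_of_sum_le hX h

/-- Deleting vertices one by one, the weight drops by at most one at each step. -/
theorem weight_le_add_card_sub (d : Pair V → ℤ) {s b : ℕ} (hb : b + 2 ≤ s) (W : Finset V)
    (hd : ∀ X ⊆ W, X.card = s → weight d X ≤ b) (hW : s ≤ W.card) :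
    weight d W ≤ b + W.card - s := by
  obtain ⟨m, hm⟩ := Nat.exists_eq_add_of_le hW
  induction m generalizing W with
  | zero =>
    have := hd W subset_rfl (by omega)
    rw [hm]
    push_cast
    linarith
  | succ m ih =>
    by_contra! hlt
    obtain ⟨v, hv, hle⟩ := exists_weight_erase_ge d (X := W) (Finset.card_pos.1 (by omega))
    have hc := Finset.card_erase_of_mem hv
    have hi := ih (W.erase v) (fun X hX => hd X (hX.trans (Finset.erase_subset v W)))
      (by omega) (by omega)
    have hc' : ((W.erase v).card : ℤ) = W.card - 1 := by omega
    rw [hc'] at hi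
    have hs : (b : ℤ) + 2 ≤ s := by exact_mod_cast hb
    have hWs : (s : ℤ) + 1 ≤ W.card := by omega
    -- With n = |W| and t = b + n − s, a drop of two or more would give (n−2)(t+1) ≤ n(t−1), that
    -- is, s ≤ b + 1.
    nlinarith

/-- Averaging alone settles b = 0: positive weight would survive some vertex deletion, down to size
s. This case is separate because the induction on s in `weight_bound` needs b ≥ 1. -/
theorem weight_nonpos (d : Pair V → ℤ) {s : ℕ} (hs : 2 ≤ s) (W : Finset V)
    (hd : ∀ X ⊆ W, X.card = s → weight d X ≤ 0) (hW : s ≤ W.card) : weight d W ≤ 0 := by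
  obtain ⟨m, hm⟩ := Nat.exists_eq_add_of_le hW
  induction m generalizing W with
  | zero => exact hd W subset_rfl (by omega)
  | succ m ih =>
    by_contra! hlt
    obtain ⟨v, hv, hle⟩ := exists_weight_erase_ge d (X := W) (Finset.card_pos.1 (by omega))
    have hc := Finset.card_erase_of_mem hv
    have hi := ih (W.erase v) (fun X hX => hd X (hX.trans (Finset.erase_subset v W)))
      (by omega) (by omega)
    have hWs : (3 : ℤ) ≤ W.card := by omega
    nlinarith

/-- Each outside vertex sends weight at most c − weight(Y) to Y. This is the tool for cutting off a
heavy set Y. -/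
theorem weight_le_of_insert_le (d : Pair V → ℤ) {Y W : Finset V} (hY : Y ⊆ W) (c : ℤ)
    (h : ∀ v ∈ W \ Y, weight d (insert v Y) ≤ c) :
    weight d W ≤ weight d Y + weight d (W \ Y) + (W \ Y).card * (c - weight d Y) := by
  have hu := weight_union d (Finset.disjoint_sdiff (s := Y) (t := W))
  rw [Finset.union_sdiff_of_subset hY] at hu
  have := Finset.sum_le_card_nsmul (W \ Y) (fun z => weight d (insert z Y) - weight d Y)
    (c - weight d Y) (fun v hv => sub_le_sub_right (h v hv) _)
  rw [nsmul_eq_mul] at this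
  linarith

/-- The threshold (s−b)(b+1) is exactly where b + |W| − s stops being at most b|W|/(b+1). -/
theorem weight_bound_of_card_le (d : Pair V → ℤ) {s b : ℕ} (hb : b + 2 ≤ s) (W : Finset V)
    (hd : ∀ X ⊆ W, X.card = s → weight d X ≤ b) (hW : s ≤ W.card)
    (hsmall : W.card ≤ (s - b) * (b + 1)) : ((b : ℤ) + 1) * weight d W ≤ b * W.card := by
  have h := weight_le_add_card_sub d hb W hd hW
  have h2 : (W.card : ℤ) ≤ ((s : ℤ) - b) * (b + 1) := by
    rw [← Nat.cast_sub (by omega)]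
    exact_mod_cast hsmall
  nlinarith

/-- The case of sparsity exactly `s - 2`. -/
theorem weight_bound_tight (d : Pair V → ℤ) (b : ℕ) (W : Finset V)
    (hd : ∀ X ⊆ W, X.card = b + 2 → weight d X ≤ b) (hW : b + 2 ≤ W.card) :
    ((b : ℤ) + 1) * weight d W ≤ b * W.card := by
  obtain ⟨n, hn⟩ : ∃ n, W.card = n := ⟨_, rfl⟩
  induction n using Nat.strong_induction_on generalizing W with
  | _ n ih =>
  by_cases hsmall : W.card ≤ (b + 2 - b) * (b + 1)
  · exact weight_bound_of_card_le d le_rfl W hd hW hsmall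
  have hlarge : 2 * b + 3 ≤ W.card := by
    rw [Nat.add_sub_cancel_left] at hsmall
    omega
  obtain ⟨x, hx⟩ : W.Nonempty := Finset.card_pos.1 (by omega)
  -- Y is a largest set carrying at least the weight of a spanning tree. The hypothesis on
  -- (b+2)-sets keeps |Y| ≤ b+1, and maximality makes every outside vertex send nonpositive total
  -- weight to Y.
  obtain ⟨Y, hYmem, hYmax⟩ := Finset.exists_max_image
    (W.powerset.filter fun Y => Y.card ≤ b + 2 ∧ (Y.card : ℤ) - 1 ≤ weight d Y) Finset.card
    ⟨{x}, by simp [hx, weight_singleton]⟩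
  simp only [Finset.mem_filter, Finset.mem_powerset] at hYmem hYmax
  obtain ⟨hYW, hYc, hYw⟩ := hYmem
  have hYc' : Y.card ≤ b + 1 := by
    by_contra! hlt
    have := hd Y hYW (by omega)
    have hcast : (Y.card : ℤ) = b + 2 := by omega
    linarith
  have hY1 : 1 ≤ Y.card := by
    simpa using hYmax {x} ⟨by simpa using hx, by simp, by simp [weight_singleton]⟩
  have hcard := Finset.card_sdiff_of_subset hYW
  have hins : ∀ v ∈ W \ Y, weight d (insert v Y) ≤ (Y.card : ℤ) - 1 := by
    intro v hv
    rw [Finset.mem_sdiff] at hv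
    by_contra! hlt
    have hci := Finset.card_insert_of_notMem hv.2
    have := hYmax (insert v Y) ⟨Finset.insert_subset hv.1 hYW, by omega, by rw [hci]; push_cast; linarith⟩
    omega
  have h1 := weight_le_of_insert_le d hYW _ hins
  have h2 := ih (W \ Y).card (by omega) (W \ Y)
    (fun X hX => hd X (hX.trans Finset.sdiff_subset)) (by omega) rfl
  have h3 : ((W \ Y).card : ℤ) = W.card - Y.card := by omega
  rw [h3] at h1 h2
  have h4 : (Y.card : ℤ) ≤ b + 1 := by exact_mod_cast hYc'
  have h5 : (1 : ℤ) ≤ W.card - Y.card := by omega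
  -- Any weight of Y above |Y| − 1 is lost again at each outside vertex, and there is at least one.
  have h6 : weight d W ≤ Y.card - 1 + weight d (W \ Y) := by nlinarith
  have h7 : ((b : ℤ) + 1) * weight d W ≤ (b + 1) * (Y.card - 1 + weight d (W \ Y)) := by gcongr
  linarith

/-- If every `s`-set has weight at most `b ≤ s - 2`, then the total weight is at most
`b n / (b + 1)`. -/
theorem weight_bound (d : Pair V → ℤ) {s b : ℕ} (hb : b + 2 ≤ s) (W : Finset V)
    (hd : ∀ X ⊆ W, X.card = s → weight d X ≤ b) (hW : s ≤ W.card) :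
    ((b : ℤ) + 1) * weight d W ≤ b * W.card := by
  rcases Nat.eq_zero_or_pos b with rfl | hb0
  · simpa using weight_nonpos d (by omega) W (by simpa using hd) hW
  induction s, hb using Nat.le_induction with
  | base => exact weight_bound_tight d b W hd hW
  | succ s hs ih =>
    by_cases hsub : ∀ X ⊆ W, X.card = s → weight d X ≤ b
    · exact ih hsub (by omega)
    push Not at hsub
    obtain ⟨Y, hYW, hYc, hYw⟩ := hsub
    by_cases hsmall : W.card ≤ (s + 1 - b) * (b + 1)
    · exact weight_bound_of_card_le d (by omega) W hd hW hsmall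
    have hlarge : 2 * s + 1 ≤ W.card := by
      -- This needs b ≥ 1. It leaves at least s+1 vertices outside Y, so averaging applies to W \ Y.
      have : 2 * s ≤ (s + 1 - b) * (b + 1) := by
        obtain ⟨r, rfl⟩ := Nat.exists_eq_add_of_le hs
        obtain ⟨c, rfl⟩ := Nat.exists_eq_add_of_le hb0
        rw [show 1 + c + 2 + r + 1 - (1 + c) = r + 3 by omega]
        nlinarith [Nat.zero_le (r * c)]
      omega
    have hcard := Finset.card_sdiff_of_subset hYW
    have hins : ∀ v ∈ W \ Y, weight d (insert v Y) ≤ b := by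
      intro v hv
      rw [Finset.mem_sdiff] at hv
      exact hd _ (Finset.insert_subset hv.1 hYW)
        (by rw [Finset.card_insert_of_notMem hv.2, hYc])
    have h1 := weight_le_of_insert_le d hYW _ hins
    have h2 := weight_le_add_card_sub d (s := s + 1) (by omega) (W \ Y)
      (fun X hX => hd X (hX.trans Finset.sdiff_subset)) (by omega)
    have h3 : ((W \ Y).card : ℤ) = W.card - s := by omega
    rw [h3] at h1 h2
    push_cast at h2
    have h4 : (2 * s + 1 : ℤ) ≤ W.card := by exact_mod_cast hlarge
    have h5 : (b : ℤ) + 2 ≤ s := by exact_mod_cast hs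
    -- As weight(Y) ≥ b+1, each of the |W| − s outside vertices sends at most −1 to Y, cancelling
    -- the term |W| − s in `h2`.
    have h6 : weight d W ≤ b := by nlinarith
    nlinarith

end weight

/-! ### From products to weights: the pointwise inequality. -/

section product

/-- Bernoulli with slack. The extra factor drives stability; it is taken with (a+1)² rather than a²
so that it stays positive, and has a logarithm, when a = 1. -/
theorem cast_le_of_lt {a w : ℕ} (h : w < a) :
    (w : ℝ) ≤ a * (((a : ℝ) + 1) / a) ^ ((w : ℤ) - a) * (1 - 1 / ((a : ℝ) + 1) ^ 2) := by
  obtain ⟨j, rfl⟩ := Nat.exists_eq_add_of_lt h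
  set a := w + j + 1 with ha
  have ha0 : (1 : ℝ) ≤ a := by rw [ha]; push_cast; linarith [(w.cast_nonneg : (0:ℝ) ≤ w), (j.cast_nonneg : (0:ℝ) ≤ j)]
  have hw : (w : ℝ) = a - 1 - j := by rw [ha]; push_cast; ring
  have hexp : (w : ℤ) - a = -((j + 1 : ℕ) : ℤ) := by rw [ha]; push_cast; ring
  have hbern : 1 - (j : ℝ) / (a + 1) ≤ ((a : ℝ) / (a + 1)) ^ j := by
    have h1 : (-2 : ℝ) ≤ -(1 / ((a : ℝ) + 1)) := by
      have : 1 / ((a : ℝ) + 1) ≤ 1 := by rw [div_le_one (by linarith)]; linarith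
      linarith
    have h2 := one_add_mul_le_pow h1 j
    have h3 : 1 + -(1 / ((a : ℝ) + 1)) = a / (a + 1) := by field_simp; ring
    rw [h3] at h2
    calc 1 - (j : ℝ) / (a + 1) = 1 + j * -(1 / ((a : ℝ) + 1)) := by ring
      _ ≤ _ := h2
  have hpow : (((a : ℝ) + 1) / a) ^ ((w : ℤ) - a) = a / (a + 1) * ((a : ℝ) / (a + 1)) ^ j := by
    rw [hexp, zpow_neg, zpow_natCast, ← inv_pow, inv_div, pow_succ, mul_comm]
  have hja : (j : ℝ) ≤ a - 1 := by rw [← sub_nonneg, ← hw]; positivity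
  have hpos : 0 ≤ 1 - (j : ℝ) / (a + 1) := by
    rw [sub_nonneg, div_le_one (by linarith)]; linarith
  have hcoef : (a : ℝ) - 1 ≤ a * (a / (a + 1)) * (1 - 1 / ((a : ℝ) + 1) ^ 2) := by
    have h1 : a * ((a : ℝ) / (a + 1)) * (1 - 1 / ((a : ℝ) + 1) ^ 2) =
        (a : ℝ) ^ 3 * (a + 2) / (a + 1) ^ 3 := by
      field_simp
      ring
    rw [h1, le_div_iff₀ (by positivity)]
    nlinarith
  calc (w : ℝ) ≤ (a - 1) * (1 - j / (a + 1)) := by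
        rw [hw, mul_sub, mul_one, mul_div_assoc', sub_le_sub_iff_left,
          div_le_iff₀ (by linarith)]
        nlinarith [(j.cast_nonneg : (0:ℝ) ≤ j)]
    _ ≤ a * (a / (a + 1)) * (1 - 1 / ((a : ℝ) + 1) ^ 2) * (a / (a + 1)) ^ j :=
        mul_le_mul hcoef hbern hpos (le_trans (by linarith) hcoef)
    _ = _ := by rw [hpow]; ring

theorem cast_le_of_ge {a w : ℕ} (ha : 1 ≤ a) (h : a ≤ w) :
    (w : ℝ) ≤ a * (((a : ℝ) + 1) / a) ^ ((w : ℤ) - a) := by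
  obtain ⟨j, rfl⟩ := Nat.exists_eq_add_of_le h
  have ha0 : (0 : ℝ) < a := by exact_mod_cast ha
  have h1 : (-2 : ℝ) ≤ 1 / a := le_trans (by norm_num) (by positivity : (0 : ℝ) ≤ 1 / a)
  have h2 := mul_le_mul_of_nonneg_left (one_add_mul_le_pow h1 j) ha0.le
  have h3 : ((a : ℝ) + 1) / a = 1 + 1 / a := by field_simp
  rw [show ((a + j : ℕ) : ℤ) - a = (j : ℤ) by push_cast; ring, zpow_natCast, h3]
  refine le_trans (le_of_eq ?_) h2
  push_cast
  field_simp

/-- Strictness comes from the last step: passing from v > a to v + 1 multiplies the bound by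
(a+1)/a, and v(a+1)/a > v + 1. -/
theorem cast_lt_of_gt {a w : ℕ} (ha : 1 ≤ a) (h : a + 1 < w) :
    (w : ℝ) < a * (((a : ℝ) + 1) / a) ^ ((w : ℤ) - a) := by
  obtain ⟨w, rfl⟩ : ∃ v, w = v + 1 := ⟨w - 1, by omega⟩
  have h1 := cast_le_of_ge ha (show a ≤ w by omega)
  have ha0 : (0 : ℝ) < a := by exact_mod_cast ha
  have haw : (a : ℝ) < w := by exact_mod_cast (show a < w by omega)
  have hr : (0 : ℝ) < ((a : ℝ) + 1) / a := by positivity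
  rw [show ((w + 1 : ℕ) : ℤ) - a = ((w : ℤ) - a) + 1 by push_cast; ring, zpow_add_one₀ hr.ne',
    ← mul_assoc]
  refine lt_of_lt_of_le ?_ (mul_le_mul_of_nonneg_right h1 hr.le)
  rw [mul_div_assoc', lt_div_iff₀ ha0]
  push_cast
  nlinarith

theorem sub_inv_sq_pos (a : ℕ) (ha : 1 ≤ a) : 0 < 1 - 1 / ((a : ℝ) + 1) ^ 2 := by
  have : (1 : ℝ) ≤ a := by exact_mod_cast ha
  rw [sub_pos, div_lt_one (by positivity)]
  nlinarith

theorem sub_inv_sq_lt_one (a : ℕ) : 1 - 1 / ((a : ℝ) + 1) ^ 2 < 1 := by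
  have : 0 < 1 / ((a : ℝ) + 1) ^ 2 := by positivity
  linarith

theorem cast_le_mul_zpow {a : ℕ} (ha : 1 ≤ a) (w : ℕ) :
    (w : ℝ) ≤ a * (((a : ℝ) + 1) / a) ^ ((w : ℤ) - a) *
      (if w < a then 1 - 1 / ((a : ℝ) + 1) ^ 2 else 1) := by
  split_ifs with h
  · exact cast_le_of_lt h
  · rw [mul_one]
    exact cast_le_of_ge ha (not_lt.1 h)

theorem cast_lt_mul_zpow {a : ℕ} (ha : 1 ≤ a) {w : ℕ} (h : w ≠ a) (h' : w ≠ a + 1) :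
    (w : ℝ) < a * (((a : ℝ) + 1) / a) ^ ((w : ℤ) - a) := by
  rcases lt_or_ge w a with hlt | hge
  · have ha0 : (0 : ℝ) < a := by exact_mod_cast ha
    refine (cast_le_of_lt hlt).trans_lt (mul_lt_of_lt_one_right (by positivity) ?_)
    exact sub_inv_sq_lt_one a
  · exact cast_lt_of_gt ha (by omega)

theorem cast_le_mul_zpow' {a : ℕ} (ha : 1 ≤ a) (w : ℕ) :
    (w : ℝ) ≤ a * (((a : ℝ) + 1) / a) ^ ((w : ℤ) - a) := by
  rcases lt_or_ge w a with hlt | hge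
  · exact (cast_lt_mul_zpow ha (by omega) (by omega)).le
  · exact cast_le_of_ge ha hge

theorem prod_zpow_eq {ι : Type*} (t : Finset ι) (r : ℝ) (hr : r ≠ 0) (f : ι → ℤ) :
    ∏ i ∈ t, r ^ f i = r ^ ∑ i ∈ t, f i := by
  classical
  induction t using Finset.induction_on with
  | empty => simp
  | insert i t hi ih => rw [Finset.prod_insert hi, Finset.sum_insert hi, zpow_add₀ hr, ih]

variable {V : Type} [Fintype V] [DecidableEq V]

/-- The excess of `G` over the constant multigraph of multiplicity `a`. -/
def excess (a : ℕ) (G : Multigraph V) : Pair V → ℤ := fun e => (G e : ℤ) - a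

theorem prod_mul_zpow_excess {a : ℕ} (ha : 1 ≤ a) (G : Multigraph V) :
    ∏ e, ((a : ℝ) * (((a : ℝ) + 1) / a) ^ ((G e : ℤ) - a)) =
      (a : ℝ) ^ Fintype.card (Pair V) *
        (((a : ℝ) + 1) / a) ^ weight (excess a G) Finset.univ := by
  have ha0 : (0 : ℝ) < a := by exact_mod_cast ha
  rw [Finset.prod_mul_distrib, prod_zpow_eq _ _ (by positivity), Finset.prod_const, weight_univ]
  rfl

theorem edgeProd_le {a : ℕ} (ha : 1 ≤ a) (G : Multigraph V) :
    (edgeProd G : ℝ) ≤ (a : ℝ) ^ Fintype.card (Pair V) *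
        (((a : ℝ) + 1) / a) ^ weight (excess a G) Finset.univ := by
  rw [← prod_mul_zpow_excess ha, edgeProd, Nat.cast_prod]
  exact Finset.prod_le_prod (fun _ _ => Nat.cast_nonneg _) fun e _ => cast_le_mul_zpow' ha (G e)

theorem edgeProd_le_mul_pow {a : ℕ} (ha : 1 ≤ a) (G : Multigraph V) :
    (edgeProd G : ℝ) ≤ (a : ℝ) ^ Fintype.card (Pair V) *
        (((a : ℝ) + 1) / a) ^ weight (excess a G) Finset.univ *
        (1 - 1 / ((a : ℝ) + 1) ^ 2) ^ (Finset.univ.filter fun e => G e < a).card := by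
  rw [← prod_mul_zpow_excess ha, edgeProd, Nat.cast_prod, ← Finset.prod_const, Finset.prod_filter,
    ← Finset.prod_mul_distrib]
  exact Finset.prod_le_prod (fun _ _ => Nat.cast_nonneg _) fun e _ => cast_le_mul_zpow ha (G e)

theorem eq_or_eq_of_edgeProd_eq {a : ℕ} (ha : 1 ≤ a) {G : Multigraph V}
    (h : (edgeProd G : ℝ) = (a : ℝ) ^ Fintype.card (Pair V) *
        (((a : ℝ) + 1) / a) ^ weight (excess a G) Finset.univ) (e : Pair V) :
    G e = a ∨ G e = a + 1 := by
  by_contra! hne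
  have ha0 : (0 : ℝ) < a := by exact_mod_cast ha
  have hpos : (0 : ℝ) < edgeProd G := by rw [h]; positivity
  have hpos' : edgeProd G ≠ 0 := by exact_mod_cast hpos.ne'
  refine h.not_lt ?_
  rw [← prod_mul_zpow_excess ha, edgeProd, Nat.cast_prod]
  refine Finset.prod_lt_prod (fun f _ => ?_) (fun f _ => cast_le_mul_zpow' ha (G f))
    ⟨e, Finset.mem_univ e, cast_lt_mul_zpow ha hne.1 hne.2⟩
  have := Finset.prod_ne_zero_iff.1 hpos' f (Finset.mem_univ f)
  exact_mod_cast Nat.pos_of_ne_zero this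

theorem edgeProd_eq {a : ℕ} (ha : 1 ≤ a) {G : Multigraph V}
    (h : ∀ e, G e = a ∨ G e = a + 1) :
    (edgeProd G : ℝ) = (a : ℝ) ^ Fintype.card (Pair V) *
        (((a : ℝ) + 1) / a) ^ weight (excess a G) Finset.univ := by
  have ha0 : (0 : ℝ) < a := by exact_mod_cast ha
  rw [← prod_mul_zpow_excess ha, edgeProd, Nat.cast_prod]
  refine Finset.prod_congr rfl fun e _ => ?_
  rcases h e with h | h
  · simp [h]
  · rw [h]
    push_cast
    rw [add_sub_cancel_left, zpow_one]
    field_simp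

theorem card_pairsIn (X : Finset V) : (pairsIn X).card = X.card.choose 2 := by
  induction X using Finset.induction_on with
  | empty => simp [pairsIn]
  | insert v X hv ih =>
    have h1 := weight_insert (fun _ : Pair V => (1 : ℤ)) hv
    have h2 : ∀ y ∈ X, pairWeight (fun _ : Pair V => (1 : ℤ)) v y = 1 := fun y hy => by
      have : v ≠ y := fun h => hv (h ▸ hy)
      simp [pairWeight, this]
    rw [Finset.sum_congr rfl h2] at h1
    simp only [weight, Finset.sum_const, nsmul_eq_mul, mul_one] at h1
    rw [Finset.card_insert_of_notMem hv, Nat.choose_succ_succ' , Nat.choose_one_right, ← ih]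
    omega

theorem card_pair_fin (n : ℕ) : Fintype.card (Pair (Fin n)) = n.choose 2 := by
  have := card_pairsIn (Finset.univ : Finset (Fin n))
  rwa [pairsIn_univ, Finset.card_univ, Finset.card_univ, Fintype.card_fin] at this

theorem weight_excess (a : ℕ) (G : Multigraph V) (X : Finset V) :
    weight (excess a G) X = (∑ e ∈ pairsIn X, G e : ℕ) - (a * X.card.choose 2 : ℕ) := by
  simp only [weight, excess, Finset.sum_sub_distrib, Finset.sum_const, card_pairsIn]
  push_cast
  simp [mul_comm]

theorem isSQGraph_iff {s a b : ℕ} {G : Multigraph V} :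
    IsSQGraph s (a * s.choose 2 + b) G ↔
      ∀ X : Finset V, X.card = s → weight (excess a G) X ≤ b := by
  refine forall_congr' fun X => forall_congr' fun hX => ?_
  rw [weight_excess, hX]
  omega

theorem weight_excess_univ_le {n s a b : ℕ} (hb : b + 2 ≤ s) (hn : s ≤ n)
    {G : Multigraph (Fin n)} (hG : G ∈ graphsF n s (a * s.choose 2 + b)) :
    ((b : ℤ) + 1) * weight (excess a G) Finset.univ ≤ b * n := by
  have := weight_bound (excess a G) hb Finset.univ (fun X _ => isSQGraph_iff.1 hG X)
    (by simpa using hn)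
  simpa using this

theorem weight_excess_univ_le_floor {n s a b : ℕ} (hb : b + 2 ≤ s) (hn : s ≤ n)
    {G : Multigraph (Fin n)} (hG : G ∈ graphsF n s (a * s.choose 2 + b)) :
    weight (excess a G) Finset.univ ≤ (⌊(b : ℝ) / ((b : ℝ) + 1) * n⌋₊ : ℤ) := by
  have h := weight_excess_univ_le hb hn hG
  rw [Int.natCast_floor_eq_floor (by positivity), Int.le_floor, div_mul_eq_mul_div,
    le_div_iff₀ (by positivity), mul_comm]
  exact_mod_cast h

theorem one_le_ratio {a : ℕ} (ha : 1 ≤ a) : 1 ≤ ((a : ℝ) + 1) / a := by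
  have ha0 : (0 : ℝ) < a := by exact_mod_cast ha
  rw [one_le_div ha0]
  linarith

theorem edgeProd_le_of_mem {n s a b : ℕ} (ha : 1 ≤ a) (hb : b + 2 ≤ s) (hn : s ≤ n)
    {G : Multigraph (Fin n)} (hG : G ∈ graphsF n s (a * s.choose 2 + b)) :
    (edgeProd G : ℝ) ≤ (a : ℝ) ^ n.choose 2 *
      (((a : ℝ) + 1) / a) ^ ⌊(b : ℝ) / ((b : ℝ) + 1) * n⌋₊ := by
  refine (edgeProd_le ha G).trans ?_
  rw [card_pair_fin, ← zpow_natCast (((a : ℝ) + 1) / a)]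
  exact mul_le_mul_of_nonneg_left
    (zpow_le_zpow_right₀ (one_le_ratio ha) (weight_excess_univ_le_floor hb hn hG)) (by positivity)

theorem exProd_le {n s a b : ℕ} (ha : 1 ≤ a) (hs : 2 ≤ s) (hb : b + 2 ≤ s) (hn : s ≤ n) :
    (exProd n s (a * s.choose 2 + b) : ℝ) ≤ (a : ℝ) ^ n.choose 2 *
      (((a : ℝ) + 1) / a) ^ ⌊(b : ℝ) / ((b : ℝ) + 1) * n⌋₊ := by
  obtain ⟨G, hG, h⟩ := (isGreatest_exProd (q := a * s.choose 2 + b) hs hn).1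
  rw [← h]
  exact edgeProd_le_of_mem ha hb hn hG

theorem edgeProd_le_exProd {n s q : ℕ} (hs : 2 ≤ s) (hn : s ≤ n) {G : Multigraph (Fin n)}
    (hG : G ∈ graphsF n s q) : edgeProd G ≤ exProd n s q :=
  (isGreatest_exProd hs hn).2 ⟨G, hG, rfl⟩

theorem weight_excess_constGraph (n a : ℕ) (X : Finset (Fin n)) :
    weight (excess a (constGraph n a)) X = 0 := by
  simp [weight, excess, constGraph]

theorem constGraph_mem (n s a b : ℕ) : constGraph n a ∈ graphsF n s (a * s.choose 2 + b) :=
  isSQGraph_iff.2 fun X _ => by rw [weight_excess_constGraph]; positivity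

theorem edgeProd_constGraph (n a : ℕ) : edgeProd (constGraph n a) = a ^ n.choose 2 := by
  simp only [edgeProd, constGraph, Finset.prod_const, Finset.card_univ, card_pair_fin]

theorem pow_le_exProd {n s : ℕ} (a b : ℕ) (hs : 2 ≤ s) (hn : s ≤ n) :
    a ^ n.choose 2 ≤ exProd n s (a * s.choose 2 + b) := by
  rw [← edgeProd_constGraph]
  exact edgeProd_le_exProd hs hn (constGraph_mem n s a b)

theorem exProd_eq_pow {n s a : ℕ} (ha : 1 ≤ a) (hs : 2 ≤ s) (hn : s ≤ n) :
    exProd n s (a * s.choose 2 + 0) = a ^ n.choose 2 := by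
  refine le_antisymm ?_ (pow_le_exProd a 0 hs hn)
  have := exProd_le ha hs hs hn (b := 0)
  simp only [Nat.cast_zero, zero_div, zero_mul, Nat.floor_zero, pow_zero, mul_one] at this
  exact_mod_cast this

/-- A multigraph attaining the product bound has all multiplicities in `{a, a + 1}`, and its
total excess is as large as allowed. -/
theorem extremal_structure {n s a b : ℕ} (ha : 1 ≤ a) (hb : b + 2 ≤ s) (hn : s ≤ n)
    {G : Multigraph (Fin n)} (hG : G ∈ graphsF n s (a * s.choose 2 + b))
    (h : (edgeProd G : ℝ) = (a : ℝ) ^ n.choose 2 *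
      (((a : ℝ) + 1) / a) ^ ⌊(b : ℝ) / ((b : ℝ) + 1) * n⌋₊) :
    weight (excess a G) Finset.univ = (⌊(b : ℝ) / ((b : ℝ) + 1) * n⌋₊ : ℤ) ∧
      ∀ e, G e = a ∨ G e = a + 1 := by
  have ha0 : (0 : ℝ) < a := by exact_mod_cast ha
  have hr : 1 < ((a : ℝ) + 1) / a := by rw [one_lt_div ha0]; linarith
  have hle := edgeProd_le ha G
  rw [h, card_pair_fin, mul_le_mul_iff_right₀ (by positivity),
    ← zpow_natCast (((a : ℝ) + 1) / a), zpow_le_zpow_iff_right₀ hr] at hle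
  have heq := le_antisymm (weight_excess_univ_le_floor hb hn hG) hle
  refine ⟨heq, eq_or_eq_of_edgeProd_eq ha ?_⟩
  rw [h, heq, card_pair_fin, zpow_natCast]

theorem prodExtremal_eq_constGraph {n s a : ℕ} (ha : 1 ≤ a) (hs : 2 ≤ s) (hn : s ≤ n) :
    prodExtremal n s (a * s.choose 2 + 0) = {constGraph n a} := by
  ext G
  rw [Set.mem_singleton_iff]
  constructor
  · rintro ⟨hG, hP⟩
    rw [exProd_eq_pow ha hs hn] at hP
    obtain ⟨hw, hG'⟩ := extremal_structure ha hs hn hG (by rw [hP]; simp)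
    have hnn : ∀ e ∈ Finset.univ, 0 ≤ excess a G e := fun e _ => by
      rcases hG' e with h | h <;> simp [excess, h]
    rw [weight_univ] at hw
    simp only [Nat.cast_zero, zero_div, zero_mul, Nat.floor_zero] at hw
    rw [Finset.sum_eq_zero_iff_of_nonneg hnn] at hw
    funext e
    have := hw e (Finset.mem_univ e)
    simp only [excess] at this
    simp only [constGraph]
    omega
  · rintro rfl
    exact ⟨constGraph_mem n s a 0, by rw [edgeProd_constGraph, exProd_eq_pow ha hs hn]⟩

end product

/-! ### Weights of vertex-disjoint stars. -/

section blocks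

theorem exists_mem_pair {V : Type} (e : Pair V) : ∃ v, v ∈ e.1 := by
  obtain ⟨e, he⟩ := e
  induction e with
  | _ x y => exact ⟨x, by simp⟩

theorem sum_card_inter {V : Type} [DecidableEq V] {ι : Type*} [Fintype ι] {A : ι → Finset V}
    (hA : ∀ i j, i ≠ j → Disjoint (A i) (A j))
    (hcov : ∀ v, ∃ i, v ∈ A i) (X : Finset V) : ∑ i, (X ∩ A i).card = X.card := by
  rw [← Finset.card_biUnion]
  · congr 1
    ext v
    simpa using fun _ => hcov v
  · intro i _ j _ hij
    exact (hA i j hij).mono Finset.inter_subset_right Finset.inter_subset_right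

variable {V : Type} [Fintype V] [DecidableEq V] {ι : Type*} [Fintype ι]

theorem pairsIn_inter (X A : Finset V) :
    pairsIn (X ∩ A) = (pairsIn X).filter (· ∈ pairsIn A) := by
  ext e
  simp only [Finset.mem_filter, mem_pairsIn, Finset.mem_inter]
  exact ⟨fun h => ⟨fun v hv => (h v hv).1, fun v hv => (h v hv).2⟩,
    fun h v hv => ⟨h.1 v hv, h.2 v hv⟩⟩

theorem weight_eq_sum_inter (d : Pair V → ℤ) {A : ι → Finset V}
    (hA : ∀ i j, i ≠ j → Disjoint (A i) (A j))
    (hd : ∀ e, (∀ i, e ∉ pairsIn (A i)) → d e = 0) (X : Finset V) :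
    weight d X = ∑ i, weight d (X ∩ A i) := by
  simp only [weight, pairsIn_inter, Finset.sum_filter]
  rw [Finset.sum_comm]
  refine Finset.sum_congr rfl fun e _ => ?_
  by_cases h : ∃ i, e ∈ pairsIn (A i)
  · obtain ⟨i, hi⟩ := h
    rw [Finset.sum_eq_single i, if_pos hi]
    · intro j _ hj
      rw [if_neg]
      intro hej
      obtain ⟨v, hv⟩ := exists_mem_pair e
      exact Finset.disjoint_left.1 (hA j i hj) (mem_pairsIn.1 hej v hv) (mem_pairsIn.1 hi v hv)
    · simp
  · push Not at h
    rw [hd e h]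
    simp

theorem weight_star {a : ℕ} {G : Multigraph V} {A : Finset V} {c : V}
    (h : ∀ e ∈ pairsIn A, G e = if c ∈ e.1 then a + 1 else a) {B : Finset V} (hB : B ⊆ A) :
    weight (excess a G) B = if c ∈ B then (B.card : ℤ) - 1 else 0 := by
  have hmono : ∀ {C : Finset V}, C ⊆ A → ∀ e ∈ pairsIn C, e ∈ pairsIn A := fun hC e he =>
    mem_pairsIn.2 fun v hv => hC (mem_pairsIn.1 he v hv)
  have h0 : ∀ C ⊆ A, c ∉ C → weight (excess a G) C = 0 := by
    intro C hC hc
    refine Finset.sum_eq_zero fun e he => ?_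
    have : c ∉ e.1 := fun hce => hc (mem_pairsIn.1 he c hce)
    simp [excess, h e (hmono hC e he), this]
  split_ifs with hc
  · have h1 := weight_insert (excess a G) (Finset.notMem_erase c B)
    rw [Finset.insert_erase hc, h0 _ ((Finset.erase_subset c B).trans hB)
      (Finset.notMem_erase c B)] at h1
    have h2 : ∀ y ∈ B.erase c, pairWeight (excess a G) c y = 1 := by
      intro y hy
      have hcy : c ≠ y := (Finset.ne_of_mem_erase hy).symm
      have hmem : (⟨s(c, y), by simpa using hcy⟩ : Pair V) ∈ pairsIn A := by
        rw [mem_pairsIn]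
        intro v hv
        rcases Sym2.mem_iff.1 hv with rfl | rfl
        · exact hB hc
        · exact hB (Finset.mem_of_mem_erase hy)
      simp [pairWeight, hcy, excess, h _ hmem]
    rw [h1, Finset.sum_congr rfl h2, Finset.sum_const, Finset.card_erase_of_mem hc, zero_add,
      nsmul_eq_mul, mul_one, Nat.cast_sub (Finset.card_pos.2 ⟨c, hc⟩), Nat.cast_one]
  · exact h0 B hB hc

theorem weight_inter_star_le {a : ℕ} {G : Multigraph V} {A : Finset V} (h : IsStarOn a G A)
    (X : Finset V) : weight (excess a G) (X ∩ A) ≤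
      (X ∩ A).card - if (X ∩ A).Nonempty then 1 else 0 := by
  split_ifs with hne
  · obtain ⟨c, -, hc⟩ := h (hne.mono Finset.inter_subset_right)
    rw [weight_star hc Finset.inter_subset_right]
    have := Finset.card_pos.2 hne
    split_ifs
    · exact le_rfl
    · omega
  · rw [Finset.not_nonempty_iff_eq_empty.1 hne, weight_empty]
    simp

theorem weight_isStarOn {a : ℕ} {G : Multigraph V} {A : Finset V} (h : IsStarOn a G A) :
    weight (excess a G) A = A.card - if A.Nonempty then 1 else 0 := by
  split_ifs with hne
  · obtain ⟨c, hcA, hc⟩ := h hne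
    rw [weight_star hc subset_rfl, if_pos hcA]
  · rw [Finset.not_nonempty_iff_eq_empty.1 hne, weight_empty]
    simp

end blocks

/-! ### Star forests attain the bound when s = b + 2. -/

section starBlocks

/-- A set of k+1 vertices meets at least two blocks, and each block met costs one: its part of the
set spans at most a star. -/
theorem starBlocks_subset_graphsF {n k a : ℕ} (hk : 1 ≤ k) :
    starBlocks n k a ⊆ graphsF n (k + 1) (a * (k + 1).choose 2 + (k - 1)) := by
  rintro G ⟨A, hdisj, hcov, hcard, hcard0, hstar, hrest⟩
  refine isSQGraph_iff.2 fun X hX => ?_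
  have hle : ∀ i, (A i).card ≤ k := fun i => by
    by_cases hi : i = 0
    · rw [hi, hcard0]
      have := Nat.div_add_mod n k
      have := Nat.mod_lt n (show k > 0 by omega)
      omega
    · exact (hcard i hi).le
  rw [weight_eq_sum_inter _ hdisj (fun e he => by simp [excess, hrest e he])]
  refine (Finset.sum_le_sum fun i _ => weight_inter_star_le (hstar i) X).trans ?_
  rw [Finset.sum_sub_distrib, ← Nat.cast_sum, sum_card_inter hdisj hcov, hX]
  have htwo : 1 < (Finset.univ.filter fun i => (X ∩ A i).Nonempty).card := by
    obtain ⟨v, hv⟩ : X.Nonempty := Finset.card_pos.1 (by omega)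
    obtain ⟨i, hi⟩ := hcov v
    obtain ⟨w, hw, hwi⟩ : ∃ w ∈ X, w ∉ A i := by
      by_contra! h
      have := Finset.card_le_card (show X ⊆ A i from h)
      have := hle i
      omega
    obtain ⟨j, hj⟩ := hcov w
    rw [Finset.one_lt_card]
    refine ⟨i, ?_, j, ?_, ?_⟩
    · simpa using ⟨v, Finset.mem_inter.2 ⟨hv, hi⟩⟩
    · simpa using ⟨w, Finset.mem_inter.2 ⟨hw, hj⟩⟩
    · rintro rfl
      exact hwi hj
  rw [Finset.sum_ite, Finset.sum_const_zero, add_zero, Finset.sum_const, nsmul_eq_mul, mul_one]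
  omega

/-- The total excess is n minus the number of nonempty blocks, which is n − ⌈n/k⌉. The strict
inequality is the form needed to compare it with a floor. -/
theorem weight_excess_starBlocks {n k a : ℕ} (hk : 1 ≤ k) {G : Multigraph (Fin n)}
    (hG : G ∈ starBlocks n k a) :
    ((k : ℤ) - 1) * n < k * (weight (excess a G) Finset.univ + 1) := by
  obtain ⟨A, hdisj, hcov, hcard, hcard0, hstar, hrest⟩ := hG
  rw [weight_eq_sum_inter _ hdisj (fun e he => by simp [excess, hrest e he])]
  have hterm : ∀ i, weight (excess a G) (Finset.univ ∩ A i) =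
      ((Finset.univ ∩ A i).card : ℤ) - if (A i).Nonempty then 1 else 0 := fun i => by
    rw [Finset.univ_inter, weight_isStarOn (hstar i)]
  rw [Finset.sum_congr rfl fun i _ => hterm i, Finset.sum_sub_distrib, ← Nat.cast_sum,
    sum_card_inter hdisj hcov, Finset.card_univ, Fintype.card_fin, Fin.sum_univ_succ]
  have h1 : ∑ i : Fin (n / k), (if (A i.succ).Nonempty then (1 : ℤ) else 0) ≤ (n / k : ℕ) := by
    refine (Finset.sum_le_card_nsmul _ _ 1 fun i _ => ?_).trans (by simp)
    split_ifs <;> simp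
  have hdm : k * (n / k) + n % k = n := Nat.div_add_mod n k
  have hdm' : (k : ℤ) * (n / k : ℕ) + (n % k : ℕ) = n := by exact_mod_cast hdm
  have hk' : (1 : ℤ) ≤ k := by exact_mod_cast hk
  split_ifs with h0
  · have hpos : 0 < n % k := by
      have := Finset.card_pos.2 h0
      omega
    have hpos' : (0 : ℤ) < (n % k : ℕ) := by exact_mod_cast hpos
    nlinarith
  · have hnn : (0 : ℤ) ≤ (n % k : ℕ) := Int.natCast_nonneg _
    nlinarith

theorem eq_or_eq_of_mem_starBlocks {n k a : ℕ} {G : Multigraph (Fin n)}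
    (hG : G ∈ starBlocks n k a) (e : Pair (Fin n)) : G e = a ∨ G e = a + 1 := by
  obtain ⟨A, -, -, -, -, hstar, hrest⟩ := hG
  by_cases h : ∃ i, e ∈ pairsIn (A i)
  · obtain ⟨i, hi⟩ := h
    obtain ⟨v, hv⟩ := exists_mem_pair e
    obtain ⟨c, -, hc⟩ := hstar i ⟨v, mem_pairsIn.1 hi v hv⟩
    rw [hc e hi]
    split_ifs <;> simp
  · push Not at h
    exact Or.inl (hrest e h)

theorem edgeProd_starBlocks {n a b : ℕ} (ha : 1 ≤ a) (hn : b + 2 ≤ n) {G : Multigraph (Fin n)}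
    (hG : G ∈ starBlocks n (b + 1) a) :
    (edgeProd G : ℝ) = (a : ℝ) ^ n.choose 2 *
      (((a : ℝ) + 1) / a) ^ ⌊(b : ℝ) / ((b : ℝ) + 1) * n⌋₊ := by
  rw [edgeProd_eq ha (eq_or_eq_of_mem_starBlocks hG), card_pair_fin,
    ← zpow_natCast (((a : ℝ) + 1) / a)]
  congr 2
  have hmem := starBlocks_subset_graphsF (by omega) hG
  refine le_antisymm (weight_excess_univ_le_floor (s := b + 2) le_rfl hn hmem) ?_
  have h := weight_excess_starBlocks (by omega) hG
  rw [← Int.lt_add_one_iff, Int.natCast_floor_eq_floor (by positivity), Int.floor_lt,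
    div_mul_eq_mul_div, div_lt_iff₀ (by positivity)]
  have h' : (b : ℤ) * n < (weight (excess a G) Finset.univ + 1) * (b + 1) := by
    push_cast at h
    linarith
  exact_mod_cast h'

theorem card_filter_div_eq (n : ℕ) {k : ℕ} (hk : 1 ≤ k) (j : ℕ) :
    (Finset.univ.filter fun v : Fin n => v.val / k = j).card = min n (k * j + k) - k * j := by
  rw [← Nat.card_Ico, ← Finset.card_map Fin.valEmbedding]
  congr 1
  ext x
  simp only [Finset.mem_map, Finset.mem_filter, Finset.mem_univ, true_and, Fin.valEmbedding_apply,
    Finset.mem_Ico, lt_min_iff]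
  constructor
  · rintro ⟨v, hv, rfl⟩
    have h1 := Nat.div_add_mod v.val k
    have h2 := Nat.mod_lt v.val (show k > 0 by omega)
    rw [hv] at h1
    have := v.2
    omega
  · rintro ⟨h1, h2, h3⟩
    refine ⟨⟨x, h2⟩, ?_, rfl⟩
    have h4 : x < (j + 1) * k := by
      rw [add_mul, one_mul, mul_comm]
      exact h3
    exact Nat.div_eq_of_lt_le (by rw [mul_comm]; exact h1) h4

theorem starBlocks_nonempty (n a : ℕ) {k : ℕ} (hk : 1 ≤ k) : (starBlocks n k a).Nonempty := by
  -- Blocks are runs of k consecutive vertices, indexed in reverse so that the last, incomplete (or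
  -- empty) run gets index 0. Their centres are the multiples of k.
  set A : Fin (n / k + 1) → Finset (Fin n) := fun i =>
    Finset.univ.filter fun v => v.val / k = n / k - i.val with hA
  have hmem : ∀ i v, v ∈ A i ↔ v.val / k = n / k - i.val := by simp [hA]
  have huniq : ∀ i j v, v ∈ A i → v ∈ A j → i = j := by
    intro i j v hi hj
    rw [hmem] at hi hj
    ext
    have := i.2
    have := j.2
    omega
  classical
  refine ⟨fun e => if (∃ i, e ∈ pairsIn (A i)) ∧ ∃ c ∈ e.1, c.val % k = 0 then a + 1 else a,
    A, ?_, ?_, ?_, ?_, ?_, ?_⟩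
  · intro i j hij
    exact Finset.disjoint_left.2 fun v hi hj => hij (huniq i j v hi hj)
  · intro v
    have : v.val / k ≤ n / k := Nat.div_le_div_right v.2.le
    exact ⟨⟨n / k - v.val / k, Nat.lt_succ_of_le (Nat.sub_le _ _)⟩,
      (hmem _ v).2 (Nat.sub_sub_self this).symm⟩
  · intro i hi
    have hi' : 0 < i.val := Nat.pos_of_ne_zero fun h => hi (Fin.ext h)
    have hi2 := i.2
    rw [hA, card_filter_div_eq n hk]
    have h1 : k * (n / k - i.val + 1) ≤ k * (n / k) := Nat.mul_le_mul_left k (by omega)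
    have h2 := Nat.mul_div_le n k
    rw [mul_add, mul_one] at h1
    omega
  · rw [hA, card_filter_div_eq n hk]
    have h1 := Nat.div_add_mod n k
    have h2 := Nat.mod_lt n (show k > 0 by omega)
    simp only [Fin.val_zero, Nat.sub_zero]
    omega
  · rintro i ⟨v, hv⟩
    rw [hmem] at hv
    have hc : k * (v.val / k) < n := (Nat.mul_div_le v.val k).trans_lt v.2
    refine ⟨⟨k * (v.val / k), hc⟩, ?_, ?_⟩
    · rw [hmem]
      simp only
      rw [Nat.mul_div_cancel_left _ (by omega), hv]
    · intro e he
      have : (∃ c ∈ e.1, c.val % k = 0) ↔ (⟨k * (v.val / k), hc⟩ : Fin n) ∈ e.1 := by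
        constructor
        · rintro ⟨c, hce, hck⟩
          have h1 := (hmem i c).1 (mem_pairsIn.1 he c hce)
          convert hce
          have h2 := Nat.div_add_mod c.val k
          rw [hck, h1, add_zero] at h2
          rw [hv, h2]
        · exact fun h => ⟨_, h, by simp⟩
      have hex : ∃ i, e ∈ pairsIn (A i) := ⟨i, he⟩
      simp only [hex, true_and, this]
  · intro e he
    exact if_neg fun h => h.1.elim he

theorem exProd_eq_of_tight {n a b : ℕ} (ha : 1 ≤ a) (hn : b + 2 ≤ n) :
    (exProd n (b + 2) (a * (b + 2).choose 2 + b) : ℝ) = (a : ℝ) ^ n.choose 2 *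
      (((a : ℝ) + 1) / a) ^ ⌊(b : ℝ) / ((b : ℝ) + 1) * n⌋₊ := by
  obtain ⟨G, hG⟩ := starBlocks_nonempty n a (show 1 ≤ b + 1 by omega)
  refine le_antisymm (exProd_le ha (by omega) le_rfl hn) ?_
  rw [← edgeProd_starBlocks ha hn hG]
  exact_mod_cast edgeProd_le_exProd (by omega) hn (starBlocks_subset_graphsF (by omega) hG)

theorem starBlocks_subset_prodExtremal {n a b : ℕ} (ha : 1 ≤ a) (hn : b + 2 ≤ n) :
    starBlocks n (b + 1) a ⊆ prodExtremal n (b + 2) (a * (b + 2).choose 2 + b) := fun G hG =>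
  ⟨starBlocks_subset_graphsF (by omega) hG, by
    have h := (edgeProd_starBlocks ha hn hG).trans (exProd_eq_of_tight ha hn).symm
    exact_mod_cast h⟩

end starBlocks

/-! ### The case s = 3: extremal multigraphs are maximum matchings. -/

section matching

/-- If every triple of vertices has excess at most one and no excess is negative, then two
distinct pairs of positive excess are disjoint. -/
theorem eq_of_mem_of_excess {n a : ℕ} {G : Multigraph (Fin n)}
    (hG : G ∈ graphsF n 3 (a * Nat.choose 3 2 + 1)) (h : ∀ e, G e = a ∨ G e = a + 1)
    {e f : Pair (Fin n)} (he : G e = a + 1) (hf : G f = a + 1) {v : Fin n}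
    (hve : v ∈ e.1) (hvf : v ∈ f.1) : e = f := by
  obtain ⟨e, hed⟩ := e
  obtain ⟨f, hfd⟩ := f
  obtain ⟨x, rfl⟩ := Sym2.mem_iff_exists.1 hve
  obtain ⟨y, rfl⟩ := Sym2.mem_iff_exists.1 hvf
  have hvx : v ≠ x := by simpa using hed
  have hvy : v ≠ y := by simpa using hfd
  by_contra hne
  have hxy : x ≠ y := by
    rintro rfl
    exact hne rfl
  have hX := isSQGraph_iff.1 hG {v, x, y} (Finset.card_eq_three.2 ⟨v, x, y, hvx, hvy, hxy, rfl⟩)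
  rw [weight_insert _ (by simp [hvx, hvy]), weight_insert _ (by simpa using hxy),
    weight_singleton, Finset.sum_pair hxy, Finset.sum_singleton] at hX
  have h1 : pairWeight (excess a G) v x = 1 := by simp [pairWeight, hvx, excess, he]
  have h2 : pairWeight (excess a G) v y = 1 := by simp [pairWeight, hvy, excess, hf]
  have h3 : 0 ≤ pairWeight (excess a G) x y := by
    rcases h ⟨s(x, y), by simpa using hxy⟩ with h | h <;>
      simp [pairWeight, hxy, excess, h]
  rw [h1, h2] at hX
  push_cast at hX
  linarith

theorem mem_starBlocks_two {n a : ℕ} {G : Multigraph (Fin n)}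
    (hG : G ∈ graphsF n 3 (a * Nat.choose 3 2 + 1)) (h : ∀ e, G e = a ∨ G e = a + 1)
    (hw : weight (excess a G) Finset.univ = (n / 2 : ℕ)) : G ∈ starBlocks n 2 a := by
  set M : Finset (Pair (Fin n)) := Finset.univ.filter fun e => G e = a + 1 with hM
  have hMmem : ∀ e, e ∈ M ↔ G e = a + 1 := by simp [hM]
  have hMcard : M.card = n / 2 := by
    have : weight (excess a G) Finset.univ = M.card := by
      rw [weight_univ, hM, Finset.card_filter, Nat.cast_sum]
      refine Finset.sum_congr rfl fun e _ => ?_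
      rcases h e with h | h <;> simp [excess, h]
    exact_mod_cast this.symm.trans hw
  let φ : Fin (n / 2) ≃ M := (finCongr hMcard.symm).trans M.equivFin.symm
  let B : Fin (n / 2) → Finset (Fin n) := fun i => (φ i).1.1.toFinset
  have hBmem : ∀ i v, v ∈ B i ↔ v ∈ (φ i).1.1 := fun i v => Sym2.mem_toFinset
  have hBcard : ∀ i, (B i).card = 2 := fun i => Sym2.card_toFinset_of_not_isDiag _ (φ i).1.2
  have hφ : ∀ i, G (φ i).1 = a + 1 := fun i => (hMmem _).1 (φ i).2
  have hBdisj : ∀ i j, i ≠ j → Disjoint (B i) (B j) := by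
    intro i j hij
    rw [Finset.disjoint_left]
    intro v hi hj
    rw [hBmem] at hi hj
    exact hij (φ.injective (Subtype.ext (eq_of_mem_of_excess hG h (hφ i) (hφ j) hi hj)))
  have hpairB : ∀ i e, e ∈ pairsIn (B i) → e = (φ i).1 := by
    intro i e he
    rw [mem_pairsIn] at he
    obtain ⟨e, hed⟩ := e
    induction e with
    | _ x y =>
      refine Subtype.ext ((Sym2.mem_and_mem_iff (by simpa using hed)).1 ⟨?_, ?_⟩).symm
      · exact (hBmem i x).1 (he x (by simp))
      · exact (hBmem i y).1 (he y (by simp))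
  let A : Fin (n / 2 + 1) → Finset (Fin n) := Fin.cons (Finset.univ \ Finset.univ.biUnion B) B
  have hA0 : A 0 = Finset.univ \ Finset.univ.biUnion B := rfl
  have hAs : ∀ i : Fin (n / 2), A i.succ = B i := fun i => rfl
  have hA0card : (A 0).card = n - 2 * (n / 2) := by
    rw [hA0, Finset.card_sdiff_of_subset (Finset.subset_univ _), Finset.card_biUnion
      (fun i _ j _ hij => hBdisj i j hij), Finset.sum_congr rfl fun i _ => hBcard i]
    simp [mul_comm]
  have h0B : ∀ i, Disjoint (A 0) (B i) := by
    intro i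
    rw [hA0]
    exact Finset.sdiff_disjoint.mono_right (Finset.subset_biUnion_of_mem B (Finset.mem_univ i))
  refine ⟨A, ?_, ?_, ?_, hA0card, ?_, ?_⟩
  · intro i j hij
    cases i using Fin.cases with
    | zero =>
      cases j using Fin.cases with
      | zero => exact absurd rfl hij
      | succ j => exact h0B j
    | succ i =>
      cases j using Fin.cases with
      | zero => exact (h0B i).symm
      | succ j => exact hBdisj i j fun h => hij (h ▸ rfl)
  · intro v
    by_cases hv : ∃ i, v ∈ B i
    · obtain ⟨i, hi⟩ := hv
      exact ⟨i.succ, hi⟩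
    · exact ⟨0, by rw [hA0]; simpa using hv⟩
  · intro i hi
    cases i using Fin.cases with
    | zero => exact absurd rfl hi
    | succ i => exact hBcard i
  · intro i hne
    cases i using Fin.cases with
    | zero =>
      obtain ⟨c, hc⟩ := hne
      refine ⟨c, hc, fun e he => ?_⟩
      -- The remainder has at most one vertex, so its star condition is vacuous.
      have h1 : (pairsIn (A 0)).card = 0 := by
        rw [card_pairsIn, hA0card]
        exact Nat.choose_eq_zero_of_lt (by omega)
      rw [Finset.card_eq_zero.1 h1] at he
      simp at he
    | succ i =>
      obtain ⟨c, hc⟩ := hne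
      refine ⟨c, hc, fun e he => ?_⟩
      rw [hpairB i e he, if_pos ((hBmem i c).1 hc), hφ i]
  · intro e he
    refine (h e).resolve_right fun he' => ?_
    obtain ⟨i, hi⟩ := φ.surjective ⟨e, (hMmem e).2 he'⟩
    refine he i.succ (mem_pairsIn.2 fun v hv => (hBmem i v).2 ?_)
    rw [hi]
    exact hv

theorem prodExtremal_three {n a : ℕ} (ha : 1 ≤ a) (hn : 3 ≤ n) :
    prodExtremal n 3 (a * Nat.choose 3 2 + 1) = starBlocks n 2 a := by
  refine subset_antisymm ?_ (starBlocks_subset_prodExtremal (b := 1) ha hn)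
  rintro G ⟨hG, hP⟩
  obtain ⟨hw, hG'⟩ := extremal_structure (b := 1) ha le_rfl hn hG
    (by rw [hP]; exact exProd_eq_of_tight (b := 1) ha hn)
  refine mem_starBlocks_two hG hG' ?_
  rw [hw]
  congr 1
  rw [show ((1 : ℕ) : ℝ) / (((1 : ℕ) : ℝ) + 1) * n = (n : ℝ) / 2 by push_cast; ring]
  exact_mod_cast Nat.floor_div_natCast (n : ℝ) 2 |>.trans (by simp)

end matching

/-! ### Product density and stability. -/

section asymptotics

open Filter

theorem floor_mul_le_self (b n : ℕ) : ⌊(b : ℝ) / ((b : ℝ) + 1) * n⌋₊ ≤ n := by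
  refine Nat.floor_le_of_le (mul_le_of_le_one_left (Nat.cast_nonneg n) ?_)
  rw [div_le_one (by positivity)]
  linarith

theorem exProd_le_mul_pow {n s a b : ℕ} (ha : 1 ≤ a) (hb : b + 2 ≤ s) (hn : s ≤ n) :
    (exProd n s (a * s.choose 2 + b) : ℝ) ≤
      (a : ℝ) ^ n.choose 2 * (((a : ℝ) + 1) / a) ^ n :=
  (exProd_le ha (by omega) hb hn).trans <| mul_le_mul_of_nonneg_left
    (pow_le_pow_right₀ (one_le_ratio ha) (floor_mul_le_self b n)) (by positivity)

theorem tendsto_div_choose_two :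
    Tendsto (fun n : ℕ => (n : ℝ) / (n.choose 2 : ℝ)) atTop (nhds 0) := by
  refine squeeze_zero' (g := fun n : ℕ => 4 / (n : ℝ)) (Eventually.of_forall fun n => by positivity)
    ?_ (tendsto_const_div_atTop_nhds_zero_nat 4)
  filter_upwards [eventually_ge_atTop 2] with n hn
  have hn' : (2 : ℝ) ≤ n := by exact_mod_cast hn
  rw [Nat.cast_choose_two, div_le_div_iff₀ (by nlinarith) (by linarith)]
  nlinarith

/-- Squeeze between a and a·r^(n/N), where n/N → 0. -/
theorem hasProdDensity {s a b : ℕ} (ha : 1 ≤ a) (hb : b + 2 ≤ s) :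
    HasProdDensity s (a * s.choose 2 + b) a := by
  have ha0 : (0 : ℝ) < a := by exact_mod_cast ha
  have hr : (0 : ℝ) < ((a : ℝ) + 1) / a := by positivity
  have hlim : Tendsto (fun n : ℕ => (a : ℝ) * (((a : ℝ) + 1) / a) ^ ((n : ℝ) / (n.choose 2 : ℝ)))
      atTop (nhds a) := by
    have := ((Real.continuousAt_const_rpow hr.ne').tendsto.comp tendsto_div_choose_two).const_mul
      (a : ℝ)
    simpa using this
  refine tendsto_of_tendsto_of_tendsto_of_le_of_le' tendsto_const_nhds hlim ?_ ?_
  · filter_upwards [eventually_ge_atTop s] with n hn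
    have hN : n.choose 2 ≠ 0 := (Nat.choose_pos (by omega)).ne'
    have h : ((a : ℝ) ^ n.choose 2) ≤ exProd n s (a * s.choose 2 + b) := by
      exact_mod_cast pow_le_exProd a b (by omega) hn
    calc (a : ℝ) = ((a : ℝ) ^ n.choose 2) ^ (1 / (n.choose 2 : ℝ)) := by
          rw [one_div, Real.pow_rpow_inv_natCast ha0.le hN]
      _ ≤ _ := Real.rpow_le_rpow (by positivity) h (by positivity)
  · filter_upwards [eventually_ge_atTop s] with n hn
    have hN : n.choose 2 ≠ 0 := (Nat.choose_pos (by omega)).ne'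
    refine (Real.rpow_le_rpow (by positivity) (exProd_le_mul_pow ha hb hn)
      (by positivity)).trans (le_of_eq ?_)
    rw [Real.mul_rpow (by positivity) (by positivity), one_div,
      Real.pow_rpow_inv_natCast ha0.le hN, ← Real.rpow_natCast _ n, ← Real.rpow_mul hr.le,
      div_eq_mul_inv (n : ℝ)]

/-- A pair above a has excess at least 1. A pair below a has excess at least −a, so adding a + 1
brings it to at least 1. -/
theorem card_diffPairs_le {V : Type} [Fintype V] [DecidableEq V] (a : ℕ) (G : Multigraph V) :
    ((diffPairs G fun _ => a).card : ℤ) ≤ weight (excess a G) Finset.univ +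
      (a + 1) * (Finset.univ.filter fun e => G e < a).card := by
  rw [weight_univ, diffPairs, Finset.card_filter, Finset.card_filter, Nat.cast_sum, Nat.cast_sum,
    Finset.mul_sum, ← Finset.sum_add_distrib]
  refine Finset.sum_le_sum fun e _ => ?_
  simp only [excess]
  split_ifs <;> push_cast <;> omega

theorem stability {s a b : ℕ} (ha : 1 ≤ a) (hb : b + 2 ≤ s) {δ : ℝ} (hδ : 0 < δ) :
    ∃ ε : ℝ, 0 < ε ∧ ∃ M : ℕ, ∀ n : ℕ, M < n → ∀ G ∈ graphsF n s (a * s.choose 2 + b),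
      (exProd n s (a * s.choose 2 + b) : ℝ) ^ (1 - ε) < (edgeProd G : ℝ) →
        IsClose δ G (constGraph n a) := by
  have ha0 : (0 : ℝ) < a := by exact_mod_cast ha
  set r : ℝ := ((a : ℝ) + 1) / a with hr
  set c : ℝ := 1 - 1 / ((a : ℝ) + 1) ^ 2 with hc
  have hr1 : 1 ≤ r := one_le_ratio ha
  have hc0 : 0 < c := sub_inv_sq_pos a ha
  have hloga : 0 ≤ Real.log a := Real.log_nonneg (by exact_mod_cast ha)
  have hlogr : 0 ≤ Real.log r := Real.log_nonneg hr1
  obtain ⟨l, hl, hl0⟩ : ∃ l, Real.log c = -l ∧ 0 < l :=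
    ⟨-Real.log c, by ring, neg_pos.2 (Real.log_neg hc0 (sub_inv_sq_lt_one a))⟩
  -- The +1 avoids division by zero when a = 1; ε ≤ 1 keeps the power 1 − ε monotone.
  set ε : ℝ := min 1 (δ * l / (2 * (a + 1) * (Real.log a + 1))) with hε
  have hε0 : 0 < ε := lt_min one_pos (by positivity)
  have hε1 : ε ≤ 1 := min_le_left _ _
  have hεle : (a + 1) * (ε * Real.log a) ≤ δ / 2 * l := by
    have h1 : ε ≤ δ * l / (2 * (a + 1) * (Real.log a + 1)) := min_le_right _ _
    rw [le_div_iff₀ (by positivity)] at h1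
    nlinarith [mul_nonneg hε0.le ha0.le]
  -- The budget δn² is split in half: ε controls the quadratic error, M the terms linear in n.
  obtain ⟨M, hM⟩ := exists_nat_ge ((1 + (a + 1) * Real.log r / l) / (δ / 2))
  refine ⟨ε, hε0, max M s, fun n hn G hG hP => ?_⟩
  have hns : s ≤ n := (le_max_right M s).trans hn.le
  have hnM : (M : ℝ) ≤ n := by exact_mod_cast (le_max_left M s).trans hn.le
  have hw : weight (excess a G) Finset.univ ≤ n :=
    (weight_excess_univ_le_floor hb hns hG).trans (by exact_mod_cast floor_mul_le_self b n)
  set x := (Finset.univ.filter fun e => G e < a).card with hx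
  have hup : (edgeProd G : ℝ) ≤ (a : ℝ) ^ n.choose 2 * r ^ n * c ^ x := by
    refine (edgeProd_le_mul_pow ha G).trans ?_
    rw [card_pair_fin, ← zpow_natCast r n]
    gcongr
  have hlow : ((a : ℝ) ^ n.choose 2) ^ (1 - ε) ≤
      (exProd n s (a * s.choose 2 + b) : ℝ) ^ (1 - ε) := by
    refine Real.rpow_le_rpow (by positivity) ?_ (by linarith)
    exact_mod_cast pow_le_exProd a b (by omega) hns
  -- Taking logarithms of a^(N(1−ε)) < a^N · r^n · c^x bounds the number x of pairs below a.
  have hlog := Real.log_lt_log (by positivity) ((hlow.trans_lt hP).trans_le hup)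
  rw [Real.log_rpow (by positivity), Real.log_mul (by positivity) (by positivity),
    Real.log_mul (by positivity) (by positivity), Real.log_pow, Real.log_pow, Real.log_pow,
    hl] at hlog
  have hN : (n.choose 2 : ℝ) ≤ (n : ℝ) ^ 2 := by
    rw [Nat.cast_choose_two]
    nlinarith [(n.cast_nonneg : (0 : ℝ) ≤ n)]
  have hxl : (x : ℝ) * l ≤ ε * Real.log a * (n : ℝ) ^ 2 + n * Real.log r := by
    have := mul_le_mul_of_nonneg_left hN (mul_nonneg hε0.le hloga)
    linarith
  have hcard : ((diffPairs G (constGraph n a)).card : ℝ) ≤ n + (a + 1) * x := by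
    have h : ((diffPairs G (constGraph n a)).card : ℤ) ≤ n + (a + 1) * x :=
      (card_diffPairs_le a G).trans (by linarith)
    exact_mod_cast h
  have hnlarge : 1 + (a + 1) * Real.log r / l ≤ δ / 2 * n := by
    have := hM.trans hnM
    rwa [div_le_iff₀ (by positivity), mul_comm (n : ℝ)] at this
  have hxle : ((a : ℝ) + 1) * x ≤ δ / 2 * (n : ℝ) ^ 2 + (a + 1) * Real.log r / l * n := by
    refine le_of_mul_le_mul_right ?_ hl0
    have h1 := mul_le_mul_of_nonneg_left hxl (by positivity : (0 : ℝ) ≤ a + 1)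
    have h2 := mul_le_mul_of_nonneg_right hεle (by positivity : (0 : ℝ) ≤ (n : ℝ) ^ 2)
    have h3 : (a + 1) * Real.log r / l * n * l = (a + 1) * Real.log r * n := by field_simp
    nlinarith
  unfold IsClose
  rw [Fintype.card_fin]
  have h4 := mul_le_mul_of_nonneg_right hnlarge (n.cast_nonneg : (0 : ℝ) ≤ n)
  nlinarith

end asymptotics

end WeightedPairs

theorem theorem2p3 (s q a b : ℕ) (hs : 2 ≤ s) (ha : 1 ≤ a) (hb : b ≤ s - 2)
    (hq : q = a * s.choose 2 + b) :
    -- extremal part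
    (∀ n : ℕ, s ≤ n →
      (a : ℝ) ^ n.choose 2 ≤ (WeightedPairs.exProd n s q : ℝ) ∧
      (WeightedPairs.exProd n s q : ℝ) ≤
        (a : ℝ) ^ n.choose 2 * (((a : ℝ) + 1) / a) ^ ⌊(b : ℝ) / ((b : ℝ) + 1) * n⌋₊ ∧
      (b = 0 →
        WeightedPairs.prodExtremal n s q = {WeightedPairs.constGraph n a} ∧
        WeightedPairs.exProd n s q = a ^ n.choose 2) ∧
      (b = s - 2 →
        WeightedPairs.starBlocks n (s - 1) a ⊆ WeightedPairs.prodExtremal n s q ∧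
        (WeightedPairs.exProd n s q : ℝ) =
          (a : ℝ) ^ n.choose 2 *
            (((a : ℝ) + 1) / a) ^ ⌊((s : ℝ) - 2) * n / ((s : ℝ) - 1)⌋₊ ∧
        (s = 3 →
          WeightedPairs.prodExtremal n 3 q = WeightedPairs.starBlocks n 2 a))) ∧
    -- asymptotic product density
    WeightedPairs.HasProdDensity s q a ∧
    -- stability
    (∀ δ : ℝ, 0 < δ → ∃ ε : ℝ, 0 < ε ∧ ∃ M : ℕ, ∀ n : ℕ, M < n →
      ∀ G ∈ WeightedPairs.graphsF n s q,
        (WeightedPairs.exProd n s q : ℝ) ^ (1 - ε) < (WeightedPairs.edgeProd G : ℝ) →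
        WeightedPairs.IsClose δ G (WeightedPairs.constGraph n a)) := by
  have hb' : b + 2 ≤ s := by omega
  subst hq
  refine ⟨fun n hn => ⟨?_, WeightedPairs.exProd_le ha hs hb' hn, ?_, ?_⟩,
    WeightedPairs.hasProdDensity ha hb', fun δ hδ => WeightedPairs.stability ha hb' hδ⟩
  · exact_mod_cast WeightedPairs.pow_le_exProd a b hs hn
  · rintro rfl
    exact ⟨WeightedPairs.prodExtremal_eq_constGraph ha hs hn, WeightedPairs.exProd_eq_pow ha hs hn⟩
  · intro hbs
    obtain rfl : s = b + 2 := by omega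
    refine ⟨WeightedPairs.starBlocks_subset_prodExtremal ha hn, ?_, ?_⟩
    · rw [WeightedPairs.exProd_eq_of_tight ha hn]
      congr 3
      push_cast
      ring
    · intro h3
      obtain rfl : b = 1 := by omega
      exact WeightedPairs.prodExtremal_three ha hn
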